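/- For a finite group $G$ and a set $S\subseteq G$ with $1\notin S$ and $S=S^{-1}$, let $\mathrm{Cay}(G,S)$ be the undirected Cayley graph with vertex set $G$ in which $g$ is adjacent to $gs$ for each $s\in S$. Let $n(d,k)$ be the largest order of such a Cayley graph (over all finite $G$ and all such $S$) that has diameter $k$ and maximum degree $d$ (put $n(d,k)=0$ if there is none), and let $$L^-(k)=\liminf_{d\to\infty}\frac{n(d,k)}{d^k}.$$ **Theorem.** Let $k\ge 7$ be odd. Then $$L^-(k)\ \ge\ \frac{2k}{3^k}.$$ Moreover, the following explicit Cayley graphs exist. Write $k=2q+1$ and $c=\lceil q/2\rceil$, let $m\ge 2$, and index the coordinates of $\mathbb{Z}_m^k$ by $0,1,\dots,k-1$. Let $D_{2k}=\langle r,s\mid r^k=s^2=1,\ srs=r^{-1}\rangle$ act on $\mathbb{Z}_m^k$ from the right by $$(x_0,\dots,x_{k-1})^{r}=(x_{k-1},x_0,\dots,x_{k-2}),\qquad (x_0,\dots,x_{k-1})^{s}=(x_{k-1},\dots,x_1,x_0),$$ and let $G=\mathbb{Z}_m^k\rtimes D_{2k}$ be the group of pairs $(\mathbf{x};y)$ with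 product $(\mathbf{x}_1;y_1)(\mathbf{x}_2;y_2)=(\mathbf{x}_1^{\,y_2}+\mathbf{x}_2;\,y_1y_2)$. With $e_0,\dots,e_{k-1}$ the standard unit vectors, put for $x\in\mathbb{Z}_m$ $$a(x)=(x\,e_{c};\,r),\qquad A(x)=(x\,e_{c-1};\,r^{-1}),\qquad b(x)=\bigl(x(e_{c-1}+e_{c}+e_{2q-c}+e_{2q-c+1});\,s\bigr),$$ and let $X=\{a(x),A(x),b(x):x\in\mathbb{Z}_m\}$. Then $|G|=2k\,m^k$, the set $X$ does not contain the identity, is closed under inverses and has exactly $3m$ elements, and every element of $G$ is a product of exactly $k$ elements of $X$. -/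

import Mathlib

open Filter

/-- `CayleyOrder d k n`: there is a finite undirected Cayley graph `Cay(G, S)`
(`S ⊆ G` inverse-closed, `1 ∉ S`) of order `n`, diameter `k` and maximum degree `d`. -/
def CayleyOrder (d k n : ℕ) : Prop :=
  ∃ (G : Type) (_ : Group G) (_ : Fintype G) (S : Set G),
    (1 : G) ∉ S ∧ (∀ s ∈ S, s⁻¹ ∈ S) ∧
    (SimpleGraph.mulCayley S).ediam = (k : ℕ∞) ∧
    (open Classical in (SimpleGraph.mulCayley S).maxDegree) = d ∧
    Fintype.card G = n

/-- `n(d, k)` for undirected Cayley graphs: the largest order of such a graph of diameter `k` and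
maximum degree `d` (`0` if there is none; by the Moore bound the set is always bounded). -/
noncomputable def maxCayleyOrder (d k : ℕ) : ℕ :=
  sSup {n : ℕ | CayleyOrder d k n}

/-- `L⁻(k) = liminf_{d → ∞} n(d, k) / d ^ k`, for undirected Cayley graphs. -/
noncomputable def lowerCayleyDensity (k : ℕ) : EReal :=
  liminf (fun d : ℕ => (((maxCayleyOrder d k : ℝ) / (d : ℝ) ^ k : ℝ) : EReal)) atTop

namespace DihedralConstruction

/-- The permutation `ψ_y` of the coordinate positions `ℤ_k`, so that `ψ_r(j) = j + 1`,
`ψ_s(j) = k - 1 - j`, and `ψ_{yz}` is `ψ_y` followed by `ψ_z`. (`sr i` is `s * r ^ i`.) -/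
def pos {k : ℕ} : DihedralGroup k → ZMod k → ZMod k
  | .r i, j => j + i
  | .sr i, j => -1 - j + i

theorem pos_one {k : ℕ} (j : ZMod k) : pos 1 j = j := by
  rw [DihedralGroup.one_def]; simp [pos]

theorem pos_mul {k : ℕ} (y z : DihedralGroup k) (j : ZMod k) :
    pos (y * z) j = pos z (pos y j) := by
  cases y <;> cases z <;> simp [pos] <;> ring

/-- The automorphism of `ℤ_m ^ k` that carries the entry in position `j` to position `ψ_y(j)`,
i.e. `x ↦ x ^ φ(y)`, where `φ(r)` is the right rotation and `φ(s)` the reversal.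
It is a right action of the dihedral group. -/
def permute {k m : ℕ} (y : DihedralGroup k) (x : ZMod k → ZMod m) : ZMod k → ZMod m :=
  fun j => x (pos y⁻¹ j)

/-- The left action `y ↦ (x ↦ x ^ φ(y⁻¹))` corresponding to the right action `permute`. -/
def action (k m : ℕ) : DihedralGroup k →* MulAut (Multiplicative (ZMod k → ZMod m)) where
  toFun y :=
    { toFun := fun x => Multiplicative.ofAdd (permute y⁻¹ x.toAdd)
      invFun := fun x => Multiplicative.ofAdd (permute y x.toAdd)
      left_inv := fun x => by
        apply Multiplicative.toAdd.injective
        funext j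
        simp [permute, ← pos_mul, pos_one]
      right_inv := fun x => by
        apply Multiplicative.toAdd.injective
        funext j
        simp [permute, ← pos_mul, pos_one]
      map_mul' := fun _ _ => rfl }
  map_one' := by
    refine MulEquiv.ext fun x => ?_
    apply Multiplicative.toAdd.injective
    funext j
    simp [permute, pos_one]
  map_mul' y z := by
    refine MulEquiv.ext fun x => ?_
    apply Multiplicative.toAdd.injective
    funext j
    change x.toAdd (pos (y * z)⁻¹⁻¹ j) = x.toAdd (pos z⁻¹⁻¹ (pos y⁻¹⁻¹ j))
    simp only [inv_inv, pos_mul]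

theorem action_apply {k m : ℕ} (y : DihedralGroup k) (x : Multiplicative (ZMod k → ZMod m)) :
    action k m y x = Multiplicative.ofAdd (permute y⁻¹ x.toAdd) := rfl

/-- The group `ℤ_m ^ k ⋊ D_{2k}`. -/
abbrev Grp (k m : ℕ) : Type :=
  Multiplicative (ZMod k → ZMod m) ⋊[action k m] DihedralGroup k

/-- The element `(x; y)` in the notation where
`(x₁; y₁)(x₂; y₂) = (x₁ ^ φ(y₂) + x₂; y₁ y₂)`, see `elt_mul_elt`. -/
def elt {k m : ℕ} (x : ZMod k → ZMod m) (y : DihedralGroup k) : Grp k m :=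
  SemidirectProduct.inr y * SemidirectProduct.inl (Multiplicative.ofAdd x)

theorem elt_mul_elt {k m : ℕ} (x₁ x₂ : ZMod k → ZMod m) (y₁ y₂ : DihedralGroup k) :
    elt x₁ y₁ * elt x₂ y₂ = elt (permute y₂ x₁ + x₂) (y₁ * y₂) := by
  apply SemidirectProduct.ext
  · apply Multiplicative.toAdd.injective
    funext j
    simp [elt, action_apply, permute, ← pos_mul]
  · simp [elt]

/-- The vector with entry `x` at the positions in `P` and `0` elsewhere. -/
def fill {k m : ℕ} (P : Finset (ZMod k)) (x : ZMod m) : ZMod k → ZMod m :=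
  fun j => if j ∈ P then x else 0

/-- `⌈q / 2⌉`, where `q = (k - 1) / 2`. -/
def half (k : ℕ) : ℕ := ((k - 1) / 2 + 1) / 2

/-- `a(x)`: the entry `x` at position `⌈q/2⌉`, with `r`. -/
def a {k m : ℕ} (x : ZMod m) : Grp k m :=
  elt (fill {(half k : ZMod k)} x) (.r 1)

/-- `A(x)`: the entry `x` at position `⌈q/2⌉ - 1`, with `r⁻¹`. -/
def A {k m : ℕ} (x : ZMod m) : Grp k m :=
  elt (fill {(half k : ZMod k) - 1} x) (.r (-1))

/-- `b(x)`: the entry `x` at positions `⌈q/2⌉ - 1`, `⌈q/2⌉`, `2q - ⌈q/2⌉`, `2q - ⌈q/2⌉ + 1`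
(where `2q = k - 1`), with `s`. -/
def b {k m : ℕ} (x : ZMod m) : Grp k m :=
  elt (fill {(half k : ZMod k) - 1, (half k : ZMod k),
    (k : ZMod k) - 1 - half k, (k : ZMod k) - 1 - half k + 1} x) (.sr 0)

/-- The generating set `X = {a(x), A(x), b(x) : x ∈ ℤ_m}`. -/
def gens (k m : ℕ) : Set (Grp k m) :=
  Set.range a ∪ Set.range A ∪ Set.range b

end DihedralConstruction

/-! Fix the types of the `k` letters of a word, that is, its projection to the dihedral group, and
let their parameters in `ZMod m` vary. The vector part of the product is then a combination of `k`
fixed vectors with free coefficients. So all elements over `y` are reached as soon as some word over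
`y` has vectors that generate all unit vectors.

Read from right to left, a word is a walk from `1` in the Cayley graph of the dihedral group for
`r`, `r⁻¹`, `s`, which is a prism. The vector of a step depends only on the edge. Each unit vector
labels one edge of either cycle, the bottom labels being shifted by `h`. The letter `b` is designed
so that a rung carries the sum of the labels of its four adjacent edges. A zigzag walk collects
every rung it passes and one of the two labels at each position; once both labels at one position
are known, the rungs yield the missing ones one after another (`full_of_rungs_down`,
`full_of_rungs_up`). The shift lets a label met on one level complete a position on the other, which
starts this chain, and one more rung often supplies a last missing label.

The shift is `q` in one orientation and `q + 1` in the other. A few families of walks, combined in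
`covered_all`, then reach every vertex in exactly `k` steps. For the density, at most two
involutions are added to reach each degree modulo 3, and for large degree a counting bound excludes
diameter below `k`. -/

/-! ### Walks on the prism. -/

/-- The vector of the edge from `i` to `i + 1`, on the top level (`false`) or the bottom level
(`true`) of a prism, when the bottom labels are shifted by `h`. -/
def prismEdge {V : Type*} (T : ℤ → V) (h : ℤ) (l : Bool) (i : ℤ) : V :=
  if l then T (i - h) else T i

/-- The vector of the rung at `i`: the sum over the four edges adjacent to it. -/
def prismRung {V : Type*} [AddCommGroup V] (T : ℤ → V) (h : ℤ) (i : ℤ) : V :=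
  T (i - 1) + T i + T (i - 1 - h) + T (i - h)

/-- `PrismWalk T h n l i S`: some walk of `n` steps on the prism leads from `0` on the top level
to `i` on level `l`, and `S` is the set of vectors of the edges it traverses. -/
inductive PrismWalk {V : Type*} [AddCommGroup V] (T : ℤ → V) (h : ℤ) :
    ℕ → Bool → ℤ → Set V → Prop
  | nil : PrismWalk T h 0 false 0 ∅
  | forward {n : ℕ} {l : Bool} {i : ℤ} {S : Set V} (w : PrismWalk T h n l i S) :
      PrismWalk T h (n + 1) l (i + 1) (insert (prismEdge T h l i) S)
  | backward {n : ℕ} {l : Bool} {i : ℤ} {S : Set V} (w : PrismWalk T h n l i S) :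
      PrismWalk T h (n + 1) l (i - 1) (insert (prismEdge T h l (i - 1)) S)
  | rung {n : ℕ} {l : Bool} {i : ℤ} {S : Set V} (w : PrismWalk T h n l i S) :
      PrismWalk T h (n + 1) (!l) i (insert (prismRung T h i) S)

namespace PrismWalk

variable {V : Type*} [AddCommGroup V] {T : ℤ → V} {h : ℤ} {n : ℕ} {l : Bool} {i : ℤ} {S : Set V}

theorem cast {n' : ℕ} {l' : Bool} {i' : ℤ} (w : PrismWalk T h n l i S) (hn : n = n')
    (hl : l = l') (hi : i = i') : PrismWalk T h n' l' i' S := by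
  subst hn hl hi; exact w

theorem exists_forward (w : PrismWalk T h n l i S) (N : ℕ) :
    ∃ S', PrismWalk T h (n + N) l (i + N) S' ∧ S ⊆ S' ∧
      ∀ j, i ≤ j → j < i + N → prismEdge T h l j ∈ S' := by
  induction N with
  | zero => exact ⟨S, w.cast rfl rfl (by simp), subset_rfl, fun j h1 h2 => by simp at h2; omega⟩
  | succ N ih =>
    obtain ⟨S', w', hS, hj⟩ := ih
    refine ⟨_, w'.forward.cast rfl rfl (by push_cast; ring),
      hS.trans (Set.subset_insert _ _), fun j h1 h2 => ?_⟩
    rcases eq_or_ne j (i + N) with rfl | hne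
    · exact Set.mem_insert _ _
    · exact Set.mem_insert_of_mem _ (hj j h1 (by push_cast at h2; omega))

theorem exists_backward (w : PrismWalk T h n l i S) (N : ℕ) :
    ∃ S', PrismWalk T h (n + N) l (i - N) S' ∧ S ⊆ S' ∧
      ∀ j, i - N ≤ j → j < i → prismEdge T h l j ∈ S' := by
  induction N with
  | zero => exact ⟨S, w.cast rfl rfl (by simp), subset_rfl, fun j h1 h2 => by simp at h1; omega⟩
  | succ N ih =>
    obtain ⟨S', w', hS, hj⟩ := ih
    refine ⟨_, w'.backward.cast rfl rfl (by push_cast; ring),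
      hS.trans (Set.subset_insert _ _), fun j h1 h2 => ?_⟩
    rcases eq_or_ne j (i - N - 1) with rfl | hne
    · exact Set.mem_insert _ _
    · exact Set.mem_insert_of_mem _ (hj j (by push_cast at h1; omega) h2)

/-- A walk continued by `N` forward steps, each followed by a change of level. -/
theorem exists_zigzag (w : PrismWalk T h n l i S) (N : ℕ) :
    ∃ S', PrismWalk T h (n + 2 * N) (Bool.xor l (decide (Odd N))) (i + N) S' ∧ S ⊆ S' ∧
      (∀ j, i ≤ j → j < i + N → T j ∈ S' ∨ T (j - h) ∈ S') ∧
      (∀ j, i < j → j ≤ i + N → prismRung T h j ∈ S') ∧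
      (N ≠ 0 → prismEdge T h l i ∈ S') := by
  induction N with
  | zero =>
    exact ⟨S, w.cast rfl (by simp) (by simp), subset_rfl, fun j h1 h2 => by simp at h2; omega,
      fun j h1 h2 => by simp at h2; omega, fun h0 => absurd rfl h0⟩
  | succ N ih =>
    obtain ⟨S', w', hS, hj, hg, he⟩ := ih
    refine ⟨_, w'.forward.rung.cast (by ring) ?_ (by push_cast; ring),
      hS.trans ((Set.subset_insert _ _).trans (Set.subset_insert _ _)),
      fun j h1 h2 => ?_, fun j h1 h2 => ?_, fun _ => ?_⟩
    · rcases Nat.even_or_odd N with hN | hN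
      · have := Nat.not_odd_iff_even.2 hN
        cases l <;> simp [this, hN.add_one]
      · have := Nat.not_odd_iff_even.2 hN.add_one
        cases l <;> simp [this, hN]
    · rcases eq_or_ne j (i + N) with rfl | hne
      · cases hb : Bool.xor l (decide (Odd N))
        · left; right; left; simp [prismEdge]
        · right; right; left; simp [prismEdge]
      · exact (hj j h1 (by push_cast at h2; omega)).imp
          (fun H => Set.mem_insert_of_mem _ (Set.mem_insert_of_mem _ H))
          (fun H => Set.mem_insert_of_mem _ (Set.mem_insert_of_mem _ H))
    · rcases eq_or_ne j (i + N + 1) with rfl | hne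
      · exact Set.mem_insert _ _
      · exact Set.mem_insert_of_mem _ (Set.mem_insert_of_mem _
          (hg j h1 (by push_cast at h2; omega)))
    · rcases Nat.eq_zero_or_pos N with rfl | hpos
      · right; left; simp [Nat.not_odd_zero]
      · exact Set.mem_insert_of_mem _ (Set.mem_insert_of_mem _ (he hpos.ne'))

end PrismWalk

/-! ### Deducing labels from rungs. -/

section Chain

variable {V : Type*} [AddCommGroup V] {T : ℤ → V} {h : ℤ} (M : AddSubgroup V)

/-- Subtracting the two known labels from the rung leaves the sum of the other two, so either of
these yields the other. -/
theorem full_of_rung_down {t : ℤ} (ht : T t ∈ M ∧ T (t - h) ∈ M) (hg : prismRung T h t ∈ M)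
    (hh : T (t - 1) ∈ M ∨ T (t - 1 - h) ∈ M) : T (t - 1) ∈ M ∧ T (t - 1 - h) ∈ M := by
  have h1 : T (t - 1) + T (t - 1 - h) ∈ M := by
    have := M.sub_mem (M.sub_mem hg ht.1) ht.2
    convert this using 1
    rw [prismRung]; abel
  rcases hh with hh | hh
  · exact ⟨hh, by simpa using M.sub_mem h1 hh⟩
  · exact ⟨by simpa using M.sub_mem h1 hh, hh⟩

theorem full_of_rung_up {t : ℤ} (ht : T (t - 1) ∈ M ∧ T (t - 1 - h) ∈ M)
    (hg : prismRung T h t ∈ M) (hh : T t ∈ M ∨ T (t - h) ∈ M) : T t ∈ M ∧ T (t - h) ∈ M := by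
  have h1 : T t + T (t - h) ∈ M := by
    have := M.sub_mem (M.sub_mem hg ht.1) ht.2
    convert this using 1
    rw [prismRung]; abel
  rcases hh with hh | hh
  · exact ⟨hh, by simpa using M.sub_mem h1 hh⟩
  · exact ⟨by simpa using M.sub_mem h1 hh, hh⟩

theorem full_of_rungs_down {a b : ℤ} (hb : T b ∈ M ∧ T (b - h) ∈ M)
    (hg : ∀ j, a < j → j ≤ b → prismRung T h j ∈ M)
    (hh : ∀ j, a ≤ j → j < b → T j ∈ M ∨ T (j - h) ∈ M) :
    ∀ j, a ≤ j → j ≤ b → T j ∈ M ∧ T (j - h) ∈ M := by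
  have key : ∀ n : ℕ, a ≤ b - n → T (b - n) ∈ M ∧ T (b - n - h) ∈ M := by
    intro n
    induction n with
    | zero => intro _; simpa using hb
    | succ n ih =>
      intro hn
      push_cast at hn
      have e : b - ((n + 1 : ℕ) : ℤ) = b - n - 1 := by push_cast; ring
      rw [e]
      exact full_of_rung_down M (ih (by omega)) (hg _ (by omega) (by omega))
        (hh _ (by omega) (by omega))
  intro j h1 h2
  have := key (b - j).toNat (by omega)
  rwa [show b - ((b - j).toNat : ℤ) = j by omega] at this

theorem full_of_rungs_up {a b : ℤ} (ha : T a ∈ M ∧ T (a - h) ∈ M)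
    (hg : ∀ j, a < j → j ≤ b → prismRung T h j ∈ M)
    (hh : ∀ j, a < j → j ≤ b → T j ∈ M ∨ T (j - h) ∈ M) :
    ∀ j, a ≤ j → j ≤ b → T j ∈ M ∧ T (j - h) ∈ M := by
  have key : ∀ n : ℕ, a + n ≤ b → T (a + n) ∈ M ∧ T (a + n - h) ∈ M := by
    intro n
    induction n with
    | zero => intro _; simpa using ha
    | succ n ih =>
      intro hn
      push_cast at hn
      have e : a + ((n + 1 : ℕ) : ℤ) = a + n + 1 := by push_cast; ring
      have ih' := ih (by omega)
      rw [e]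
      refine full_of_rung_up M ?_ (hg _ (by omega) (by omega)) (hh _ (by omega) (by omega))
      simpa using ih'
  intro j h1 h2
  have := key (j - a).toNat (by omega)
  rwa [show a + ((j - a).toNat : ℤ) = j by omega] at this

variable {k : ℤ}

/-- A periodic family lies in `M` as soon as one full period does. -/
theorem forall_mem_of_period (hk : 0 < k) (hT : Function.Periodic T k) (a : ℤ)
    (H : ∀ j, a ≤ j → j < a + k → T j ∈ M) (j : ℤ) : T j ∈ M := by
  have h1 := H (a + (j - a) % k) (by have := Int.emod_nonneg (j - a) hk.ne'; omega)
    (by have := Int.emod_lt_of_pos (j - a) hk; omega)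
  have h2 := hT.int_mul ((j - a) / k) (a + (j - a) % k)
  have h3 : a + (j - a) % k + ((j - a) / k) * k = j := by
    have := Int.mul_ediv_add_emod (j - a) k
    linarith
  simp only [Int.cast_id] at h2
  rw [h3] at h2
  rwa [h2]

/-- If all but one label of a period `(a, a + k]` are in `M`, then a rung adjacent to the
remaining one supplies it. -/
theorem forall_mem_of_period_of_rung (hT : Function.Periodic T k) (a : ℤ)
    (hh : 2 ≤ h) (hhk : h + 2 ≤ k)
    (H : ∀ j, a < j → j < a + k → T j ∈ M) {t : ℤ} (hg : prismRung T h t ∈ M)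
    (ht : t = a ∨ t - h = a ∨ t - 1 - h = a) (j : ℤ) : T j ∈ M := by
  have hsum : T (t - 1) + T t + T (t - 1 - h) + T (t - h) ∈ M := hg
  have up : ∀ j, T (j + k) ∈ M → T j ∈ M := fun j hj => by rwa [hT j] at hj
  -- The bounds `2 ≤ h ≤ k - 2` keep the four labels of a rung distinct modulo `k`, so the other
  -- three are already known.
  have ha : T a ∈ M := by
    rcases ht with rfl | ht | ht
    · have h1 : T (t - 1) ∈ M := up _ (H _ (by omega) (by omega))
      have h2 : T (t - 1 - h) ∈ M := up _ (H _ (by omega) (by omega))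
      have h3 : T (t - h) ∈ M := up _ (H _ (by omega) (by omega))
      have := M.sub_mem (M.sub_mem (M.sub_mem hsum h1) h2) h3
      convert this using 1; abel
    · have h1 : T (t - 1) ∈ M := H _ (by omega) (by omega)
      have h2 : T t ∈ M := H _ (by omega) (by omega)
      have h3 : T (t - 1 - h) ∈ M := up _ (H _ (by omega) (by omega))
      have := M.sub_mem (M.sub_mem (M.sub_mem hsum h1) h2) h3
      rw [← ht]
      convert this using 1; abel
    · have h1 : T (t - 1) ∈ M := H _ (by omega) (by omega)
      have h2 : T t ∈ M := H _ (by omega) (by omega)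
      have h3 : T (t - h) ∈ M := H _ (by omega) (by omega)
      have := M.sub_mem (M.sub_mem (M.sub_mem hsum h1) h2) h3
      rw [← ht]
      convert this using 1; abel
  refine forall_mem_of_period M (by omega) hT a (fun j h1 h2 => ?_) j
  rcases h1.eq_or_lt with rfl | h1
  · exact ha
  · exact H j h1 h2

end Chain

/-- Some walk of `n` steps leads from `0` on the top level to `D` on level `l`, and the vectors
of its edges generate all labels. -/
def GeneratingWalk {V : Type*} [AddCommGroup V] (T : ℤ → V) (h : ℤ) (n : ℕ) (l : Bool)
    (D : ℤ) : Prop :=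
  ∃ S, PrismWalk T h n l D S ∧ ∀ j, T j ∈ AddSubgroup.closure S

/-! ### Generating walks to the various targets. -/

section Walks

variable {V : Type*} [AddCommGroup V] {T : ℤ → V} {h : ℤ} {q : ℕ}

/-- The walk is straight up to `p - 2u`, zigzags up to `p`, and is straight again. With shift `p`,
the bottom label at `p` is `T 0`, collected by the first edge. Hence position `p` is full, and the
chain runs down through the zigzag; its bottom labels are the negative ones. -/
theorem exists_monotone_walk (p u L : ℕ) (hu : 2 * u ≤ p) (hp : 1 ≤ p) (hL : p < L) :
    ∃ S, PrismWalk T p (L + 2 * u) false L S ∧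
      (∀ j : ℤ, 0 ≤ j → j < L → T j ∈ AddSubgroup.closure S) ∧
      ∀ j : ℤ, -(2 * u) ≤ j → j < 0 → T j ∈ AddSubgroup.closure S := by
  obtain ⟨S₁, w₁, -, e₁⟩ := (PrismWalk.nil (T := T) (h := p)).exists_forward (p - 2 * u)
  obtain ⟨S₂, w₂, s₂, e₂, g₂, f₂⟩ := w₁.exists_zigzag (2 * u)
  have hodd : Bool.xor false (decide (Odd (2 * u))) = false := by simp
  rw [hodd] at w₂
  obtain ⟨S₃, w₃, s₃, e₃⟩ := w₂.exists_forward (L - p)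
  refine ⟨S₃, w₃.cast (by omega) rfl (by push_cast; omega), ?_⟩
  have sub := AddSubgroup.subset_closure (k := S₃)
  set M := AddSubgroup.closure S₃
  simp only [prismEdge, Bool.false_eq_true, if_false] at e₁ e₃ f₂
  have hlow : ∀ j : ℤ, 0 ≤ j → j < p - 2 * u → T j ∈ M := fun j h1 h2 =>
    sub (s₃ (s₂ (e₁ j h1 (by omega))))
  have hhigh : ∀ j : ℤ, p ≤ j → j < L → T j ∈ M := fun j h1 h2 =>
    sub (e₃ j (by push_cast; omega) (by push_cast; omega))
  -- If `2u = p`, the first straight stretch is empty and `T 0` comes from the first edge of the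
  -- zigzag.
  have hzero : T 0 ∈ M := by
    rcases hu.lt_or_eq with hu | hu
    · exact hlow 0 le_rfl (by omega)
    · have := sub (s₃ (f₂ (by omega)))
      rwa [show (0 : ℤ) + ((p - 2 * u : ℕ) : ℤ) = 0 by omega] at this
  have full := full_of_rungs_down M (T := T) (h := p) (a := p - 2 * u) (b := p)
    ⟨hhigh p le_rfl (by omega), by simpa using hzero⟩
    (fun j h1 h2 => sub (s₃ (g₂ j (by omega) (by omega))))
    (fun j h1 h2 => (e₂ j (by omega) (by omega)).imp
      (fun H => sub (s₃ H)) (fun H => sub (s₃ H)))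
  refine ⟨fun j h1 h2 => ?_, fun j h1 h2 => ?_⟩
  · by_cases hj : j < p - 2 * u
    · exact hlow j h1 hj
    by_cases hj' : p ≤ j
    · exact hhigh j hj' h2
    · exact (full j (by omega) (by omega)).1
  · have := (full (j + p) (by omega) (by omega)).2
    simpa using this

/-- Target `-2u` on the top level. -/
theorem generatingWalk_top_even {k : ℕ} (hT : Function.Periodic T k) (p u : ℕ) (hu : 2 * u ≤ p)
    (hp : 1 ≤ p) (hk : p + 2 * u < k) : GeneratingWalk T p k false (k - 2 * u) := by
  -- With `L = k - 2u` the walk has `k` steps, and its labels fill the period that starts at `-2u`.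
  obtain ⟨S, w, H₁, H₂⟩ := exists_monotone_walk (T := T) p u (k - 2 * u) hu hp (by omega)
  refine ⟨S, w.cast (by omega) rfl (by omega), ?_⟩
  refine forall_mem_of_period _ (by omega) hT (-(2 * u)) fun j h1 h2 => ?_
  by_cases hj : j < 0
  · exact H₂ j h1 hj
  · exact H₁ j (by omega) (by omega)

/-- Target `-(2u + 1)` on the bottom level. -/
theorem generatingWalk_bottom_odd {k : ℕ} (hT : Function.Periodic T k) (p u : ℕ)
    (hu : 2 * u ≤ p) (hp : 2 ≤ p) (hpk : p + 2 ≤ k) (hk : p + 2 * u + 1 < k) :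
    GeneratingWalk T p k true (k - (2 * u + 1)) := by
  -- This walk has `k - 1` steps and gives `k - 1` consecutive labels. The last step is a rung
  -- adjacent to the edge with the missing label.
  obtain ⟨S, w, H₁, H₂⟩ := exists_monotone_walk (T := T) p u (k - (2 * u + 1)) hu (by omega)
    (by omega)
  have e : ((k - (2 * u + 1) : ℕ) : ℤ) = k - (2 * u + 1) := by omega
  refine ⟨_, w.rung.cast (by omega) rfl e, ?_⟩
  have mono := AddSubgroup.closure_mono (Set.subset_insert (prismRung T p (k - (2 * u + 1) : ℕ)) S)
  refine forall_mem_of_period_of_rung _ hT (k - (2 * u + 1)) (by omega) (by omega)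
    (fun j h1 h2 => ?_) (AddSubgroup.subset_closure (Set.mem_insert _ _)) (Or.inl e)
  rw [← hT.sub_eq j]
  by_cases hj : j - k < 0
  · exact mono (H₂ _ (by omega) hj)
  · exact mono (H₁ _ (by omega) (by omega))

/-- Target `-q` on the bottom level, for odd `q` and shift `q + 1`. -/
theorem generatingWalk_bottom_succ (hT : Function.Periodic T ((2 * q + 1 : ℕ) : ℤ)) (hq : 2 ≤ q)
    (hodd : Odd q) : GeneratingWalk T (q + 1) (2 * q + 1) true (q + 1) := by
  obtain ⟨S₁, w₁, -, e₁, g₁, f₁⟩ :=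
    (PrismWalk.nil (T := T) (h := q + 1)).exists_zigzag (q - 1)
  have hpar : Bool.xor false (decide (Odd (q - 1))) = false := by
    obtain ⟨t, rfl⟩ := hodd; simp
  rw [hpar] at w₁
  obtain ⟨S₂, w₂, s₂, e₂⟩ := w₁.exists_forward 2
  have e : (0 : ℤ) + ((q - 1 : ℕ) : ℤ) + (2 : ℕ) = q + 1 := by omega
  refine ⟨_, w₂.rung.cast (by omega) rfl e, ?_⟩
  rw [e]
  set S := insert (prismRung T (q + 1) (q + 1)) S₂ with hS
  have s₃ : S₂ ⊆ S := Set.subset_insert _ _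
  have sub := AddSubgroup.subset_closure (k := S)
  set M := AddSubgroup.closure S
  simp only [prismEdge, Bool.false_eq_true, if_false] at f₁ e₂
  have hq1 : T (q - 1) ∈ M := sub (s₃ (e₂ _ (by omega) (by omega)))
  have hq0 : T q ∈ M := sub (s₃ (e₂ _ (by omega) (by omega)))
  -- By periodicity the bottom label at `0` is `T (-(q + 1)) = T q`, so position `0` is full and the
  -- chain runs upwards. Only `T (-1)` is left for the final rung.
  have full := full_of_rungs_up M (T := T) (h := q + 1) (a := 0) (b := q - 1)
    ⟨sub (s₃ (s₂ (f₁ (by omega)))), by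
      rw [← hT]; convert hq0 using 2; push_cast; ring⟩
    (fun j h1 h2 => sub (s₃ (s₂ (g₁ j h1 (by omega)))))
    (fun j h1 h2 => by
      rcases h2.lt_or_eq with h2 | rfl
      · exact (e₁ j h1.le (by omega)).imp
          (fun H => sub (s₃ (s₂ H))) (fun H => sub (s₃ (s₂ H)))
      · exact Or.inl hq1)
  refine forall_mem_of_period_of_rung M hT (-1) (h := q + 1) (by omega) (by omega)
    (fun j h1 h2 => ?_) (t := q + 1) (sub (Set.mem_insert _ _)) ?_
  · by_cases hj : j ≤ q
    · rcases hj.lt_or_eq with hj | rfl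
      · exact (full j (by omega) (by omega)).1
      · exact hq0
    · have := (full (j - q) (by omega) (by omega)).2
      rw [← hT] at this
      convert this using 2
      push_cast; ring
  · exact Or.inr (Or.inr (by ring))

/-- The labels generated by a walk that goes from `0` to `q`, changing level at `1, …, d`, and
returns from `q` to `d` on the bottom level. -/
theorem uturn_generates (hT : Function.Periodic T ((2 * q + 1 : ℕ) : ℤ)) (hq : 2 ≤ q)
    (hh : h = q ∨ h = q + 1) (M : AddSubgroup V) {d : ℕ} (hd : d < q)
    (hg : ∀ j : ℤ, 0 < j → j ≤ d → prismRung T h j ∈ M) (hgq : prismRung T h q ∈ M)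
    (hhalf : ∀ j : ℤ, 0 ≤ j → j < d → T j ∈ M ∨ T (j - h) ∈ M)
    (hfull : ∀ j : ℤ, d ≤ j → j < q → T j ∈ M ∧ T (j - h) ∈ M) (j : ℤ) : T j ∈ M := by
  have down := full_of_rungs_down M (T := T) (h := h) (a := 0) (b := d)
    (hfull d le_rfl (by omega)) hg hhalf
  have full : ∀ j : ℤ, 0 ≤ j → j < q → T j ∈ M ∧ T (j - h) ∈ M := fun j h1 h2 => by
    by_cases hj : j ≤ d
    · exact down j h1 hj
    · exact hfull j (by omega) h2
  -- The positions `0, …, q - 1` give `2q` of the `2q + 1` labels. The missing one is `T q` for `h =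
  -- q` and `T (-1)` for `h = q + 1`; the rung at the turning point `q` contains either.
  rcases hh with rfl | rfl
  · refine forall_mem_of_period_of_rung M hT q (h := q) (by omega) (by omega)
      (fun j h1 h2 => ?_) (t := q) hgq (Or.inl rfl) j
    rw [← hT.sub_eq]
    by_cases hj : j < 2 * q + 1
    · have := (full (j - (2 * q + 1) + q) (by omega) (by omega)).2
      convert this using 2
      push_cast; ring
    · exact (full _ (by omega) (by omega)).1
  · refine forall_mem_of_period_of_rung M hT (-1) (h := q + 1) (by omega) (by omega)
      (fun j h1 h2 => ?_) (t := q) hgq (Or.inr (Or.inl (by ring))) j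
    by_cases hj : j < q
    · exact (full j (by omega) hj).1
    · have := (full (j - q) (by omega) (by omega)).2
      rw [← hT] at this
      convert this using 2
      push_cast; ring

/-- Target `d` on the bottom level for even `d`, on the top level for odd `d`. -/
theorem generatingWalk_uturn (hT : Function.Periodic T ((2 * q + 1 : ℕ) : ℤ)) (hq : 2 ≤ q)
    (hh : h = q ∨ h = q + 1) {d : ℕ} (hd : d < q) :
    GeneratingWalk T h (2 * q + 1) (decide (Even d)) d := by
  rcases Nat.even_or_odd d with hpar | hpar
  · obtain ⟨S₁, w₁, -, e₁, g₁, -⟩ := (PrismWalk.nil (T := T) (h := h)).exists_zigzag d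
    obtain ⟨S₂, w₂, s₂, e₂⟩ := w₁.exists_forward (q - d)
    obtain ⟨S₃, w₃, s₃, e₃⟩ := w₂.rung.exists_backward (q - d)
    have hodd : ¬ Odd d := Nat.not_odd_iff_even.2 hpar
    have e : (0 : ℤ) + (d : ℤ) + ((q - d : ℕ) : ℤ) = q := by omega
    refine ⟨S₃, w₃.cast (by omega) (by simp [hpar, hodd]) (by omega), ?_⟩
    simp only [hodd, prismEdge, e, decide_false, Bool.xor_false, Bool.not_false, if_true,
      Bool.false_eq_true, if_false] at e₁ e₂ s₃ e₃
    have sub := AddSubgroup.subset_closure (k := S₃)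
    have s₂' : S₂ ⊆ S₃ := (Set.subset_insert _ _).trans s₃
    exact uturn_generates hT hq hh _ hd
      (fun j h1 h2 => sub (s₂' (s₂ (g₁ j h1 (by omega)))))
      (sub (s₃ (Set.mem_insert _ _)))
      (fun j h1 h2 => (e₁ j h1 (by omega)).imp
        (fun H => sub (s₂' (s₂ H))) (fun H => sub (s₂' (s₂ H))))
      (fun j h1 h2 => ⟨sub (s₂' (e₂ j (by omega) (by omega))), sub (e₃ j (by omega) h2)⟩)
  -- For odd `d` the zigzag stops at `d - 1` and the rung at `d` is crossed last, which changes the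
  -- final level but not the length.
  · obtain ⟨S₁, w₁, -, e₁, g₁, -⟩ := (PrismWalk.nil (T := T) (h := h)).exists_zigzag (d - 1)
    obtain ⟨S₂, w₂, s₂, e₂⟩ := w₁.exists_forward (q - d + 1)
    obtain ⟨S₃, w₃, s₃, e₃⟩ := w₂.rung.exists_backward (q - d)
    have hd1 : 1 ≤ d := hpar.pos
    have hodd : ¬ Odd (d - 1) := by obtain ⟨t, rfl⟩ := hpar; simp
    have heven : ¬ Even d := Nat.not_even_iff_odd.2 hpar
    have e : (0 : ℤ) + ((d - 1 : ℕ) : ℤ) + ((q - d + 1 : ℕ) : ℤ) = q := by omega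
    have e' : (q : ℤ) - ((q - d : ℕ) : ℤ) = d := by omega
    refine ⟨_, w₃.rung.cast (by omega) (by simp [heven, hodd]) (by omega), ?_⟩
    simp only [hodd, prismEdge, e, e', decide_false, Bool.xor_false, Bool.not_false, if_true,
      Bool.false_eq_true, if_false] at e₁ e₂ s₃ e₃ ⊢
    set S := insert (prismRung T h d) S₃
    have sub := AddSubgroup.subset_closure (k := S)
    have s₄ : S₃ ⊆ S := Set.subset_insert _ _
    have s₂' : S₂ ⊆ S := ((Set.subset_insert _ _).trans s₃).trans s₄
    refine uturn_generates hT hq hh _ hd (fun j h1 h2 => ?_)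
      (sub (s₄ (s₃ (Set.mem_insert _ _)))) (fun j h1 h2 => ?_)
      (fun j h1 h2 => ⟨sub (s₂' (e₂ j (by omega) (by omega))), sub (s₄ (e₃ j h1 h2))⟩)
    · rcases h2.lt_or_eq with h2 | rfl
      · exact sub (s₂' (s₂ (g₁ j h1 (by omega))))
      · exact sub (Set.mem_insert _ _)
    · by_cases hj : j < d - 1
      · exact (e₁ j h1 (by omega)).imp
          (fun H => sub (s₂' (s₂ H))) (fun H => sub (s₂' (s₂ H)))
      · exact Or.inl (sub (s₂' (e₂ j (by omega) (by omega))))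

/-- Shared by both parities of `q` below. The label `T (-1)` is the bottom one at `q`, so position
`q` is full and the chain runs down to `2`. Only `T (q + 1)` is then missing, and the rung at `q +
1` contains it. -/
theorem distant_generates_succ (hT : Function.Periodic T ((2 * q + 1 : ℕ) : ℤ)) (hq : 3 ≤ q)
    (M : AddSubgroup V) (hT0 : T 0 ∈ M) (hT1 : T 1 ∈ M) (hTq : T q ∈ M) (hBq : T (-1) ∈ M)
    (hg : ∀ j : ℤ, 2 < j → j ≤ q + 1 → prismRung T (q + 1) j ∈ M)
    (hhalf : ∀ j : ℤ, 2 ≤ j → j < q → T j ∈ M ∨ T (j - (q + 1)) ∈ M) (j : ℤ) : T j ∈ M := by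
  have down := full_of_rungs_down M (T := T) (h := q + 1) (a := 2) (b := q)
    ⟨hTq, by simpa using hBq⟩ (fun j h1 h2 => hg j h1 (by omega)) hhalf
  refine forall_mem_of_period_of_rung M hT (q + 1) (h := q + 1) (by omega) (by omega)
    (fun j h1 h2 => ?_) (t := q + 1) (hg _ (by omega) le_rfl) (Or.inl rfl) j
  rw [← hT.sub_eq]
  by_cases hj : j < 2 * q + 1
  · have := (down (j - (2 * q + 1) + (q + 1)) (by omega) (by omega)).2
    convert this using 2
    push_cast; ring
  · by_cases hj2 : j < 2 * q + 3
    · rcases (show j = 2 * q + 1 ∨ j = 2 * q + 2 by omega) with rfl | rfl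
      · convert hT0 using 2; push_cast; ring
      · convert hT1 using 2; push_cast; ring
    · exact (down _ (by push_cast; omega) (by push_cast; omega)).1

/-- Target `q` for the shift `q + 1`, on the bottom level for even `q`, on the top level for
odd `q`. -/
theorem generatingWalk_distant_succ (hT : Function.Periodic T ((2 * q + 1 : ℕ) : ℤ))
    (hq : 3 ≤ q) : GeneratingWalk T (q + 1) (2 * q + 1) (decide (Even q)) q := by
  -- Two straight steps skip two rungs, which leaves room for overshooting to `q + 1` and returning.
  obtain ⟨S₀, w₀, -, e₀⟩ := (PrismWalk.nil (T := T) (h := q + 1)).exists_forward 2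
  simp only [prismEdge, Bool.false_eq_true, if_false] at e₀
  rcases Nat.even_or_odd q with hpar | hpar
  · obtain ⟨S₁, w₁, s₁, e₁, g₁, -⟩ := w₀.exists_zigzag (q - 2)
    have hodd : ¬ Odd (q - 2) := by
      obtain ⟨t, rfl⟩ := hpar; rw [Nat.not_odd_iff_even]; exact ⟨t - 1, by omega⟩
    have e : (0 : ℤ) + (2 : ℕ) + ((q - 2 : ℕ) : ℤ) = q := by omega
    rw [e] at w₁
    have w₂ := w₁.forward.rung.backward
    simp only [hodd, prismEdge, decide_false, Bool.xor_false, Bool.not_false, if_true,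
      Bool.false_eq_true, if_false, add_sub_cancel_right] at w₂
    refine ⟨_, w₂.cast (by omega) (by simp [hpar]) rfl, ?_⟩
    have sub := AddSubgroup.subset_closure (k := insert (T (q - (q + 1)))
      (insert (prismRung T (q + 1) (q + 1)) (insert (T q) S₁)))
    have s₂ : S₁ ⊆ _ := (Set.subset_insert (T q) S₁).trans ((Set.subset_insert
      (prismRung T (q + 1) (q + 1)) _).trans (Set.subset_insert (T (q - (q + 1))) _))
    refine distant_generates_succ hT hq _ (sub (s₂ (s₁ (e₀ 0 (by omega) (by omega)))))
      (sub (s₂ (s₁ (e₀ 1 (by omega) (by omega)))))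
      (sub (by simp)) ?_ (fun j h1 h2 => ?_) (fun j h1 h2 => ?_)
    · have := sub (Set.mem_insert _ _)
      simpa using this
    · rcases h2.lt_or_eq with h2 | rfl
      · exact sub (s₂ (g₁ j (by omega) (by omega)))
      · exact sub (by simp)
    · exact (e₁ j (by omega) (by omega)).imp (fun H => sub (s₂ H)) (fun H => sub (s₂ H))
  · obtain ⟨S₁, w₁, s₁, e₁, g₁, -⟩ := w₀.exists_zigzag (q - 3)
    obtain ⟨S₂, w₂, s₂, e₂⟩ := w₁.exists_forward 2
    have hodd : ¬ Odd (q - 3) := by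
      obtain ⟨t, rfl⟩ := hpar; rw [Nat.not_odd_iff_even]; exact ⟨t - 1, by omega⟩
    have heven : ¬ Even q := Nat.not_even_iff_odd.2 hpar
    have e : (0 : ℤ) + (2 : ℕ) + ((q - 3 : ℕ) : ℤ) + (2 : ℕ) = q + 1 := by omega
    rw [e] at w₂
    have w₃ := w₂.rung.backward.rung
    simp only [hodd, prismEdge, decide_false, Bool.xor_false, Bool.not_false, if_true,
      Bool.false_eq_true, if_false, add_sub_cancel_right, Bool.not_true] at w₃ e₂
    refine ⟨_, w₃.cast (by omega) (by simp [heven]) rfl, ?_⟩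
    have sub := AddSubgroup.subset_closure (k := insert (prismRung T (q + 1) q)
      (insert (T (q - (q + 1))) (insert (prismRung T (q + 1) (q + 1)) S₂)))
    have s₃ : S₂ ⊆ _ := (Set.subset_insert (prismRung T (q + 1) (q + 1)) S₂).trans
      ((Set.subset_insert (T (q - (q + 1))) _).trans (Set.subset_insert (prismRung T (q + 1) q) _))
    refine distant_generates_succ hT hq _ (sub (s₃ (s₂ (s₁ (e₀ 0 (by omega) (by omega))))))
      (sub (s₃ (s₂ (s₁ (e₀ 1 (by omega) (by omega))))))
      (sub (s₃ (e₂ q (by omega) (by omega)))) ?_ (fun j h1 h2 => ?_) (fun j h1 h2 => ?_)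
    · have := sub (Set.mem_insert_of_mem _ (Set.mem_insert _ _))
      simpa using this
    · rcases (show j < q ∨ j = q ∨ j = q + 1 by omega) with h2 | rfl | rfl
      · exact sub (s₃ (s₂ (g₁ j (by omega) (by omega))))
      · exact sub (by simp)
      · exact sub (by simp)
    · by_cases hj : j < q - 1
      · exact (e₁ j (by omega) (by omega)).imp (fun H => sub (s₃ (s₂ H)))
          (fun H => sub (s₃ (s₂ H)))
      · exact Or.inl (sub (s₃ (e₂ j (by omega) (by omega))))

/-- Target `q` on the bottom level for the shift `q`, when `q` is even. -/
theorem generatingWalk_distant (hT : Function.Periodic T ((2 * q + 1 : ℕ) : ℤ))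
    (hq : 4 ≤ q) (hpar : Even q) : GeneratingWalk T q (2 * q + 1) true q := by
  obtain ⟨S₀, w₀, s₀, e₀⟩ := (PrismWalk.nil (T := T) (h := q)).rung.exists_forward 2
  obtain ⟨S₁, w₁, s₁, e₁, g₁, -⟩ := w₀.exists_zigzag (q - 3)
  obtain ⟨S₂, w₂, s₂, e₂⟩ := w₁.exists_forward 2
  have hodd : Odd (q - 3) := by
    obtain ⟨t, rfl⟩ := hpar; exact ⟨t - 2, by omega⟩
  have e : (0 : ℤ) + (2 : ℕ) + ((q - 3 : ℕ) : ℤ) + (2 : ℕ) = q + 1 := by omega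
  rw [e] at w₂
  have w₃ := w₂.rung.backward
  simp only [hodd, prismEdge, decide_true, Bool.xor_true, Bool.not_false, if_true,
    Bool.false_eq_true, if_false, add_sub_cancel_right, Bool.not_true, sub_self] at w₃ e₂ e₀
  refine ⟨_, w₃.cast (by omega) rfl rfl, ?_⟩
  have sub := AddSubgroup.subset_closure (k := insert (T 0) (insert (prismRung T q (q + 1)) S₂))
  have s₃ : S₂ ⊆ _ := (Set.subset_insert (prismRung T q (q + 1)) S₂).trans
    (Set.subset_insert (T 0) _)
  set M := AddSubgroup.closure (insert (T 0) (insert (prismRung T q (q + 1)) S₂))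
  have hT0 : T 0 ∈ M := sub (by simp)
  have hB0 : T (-q) ∈ M := by
    simpa using sub (s₃ (s₂ (s₁ (e₀ 0 (by omega) (by omega)))))
  have hB1 : T (1 - q) ∈ M := sub (s₃ (s₂ (s₁ (e₀ 1 (by omega) (by omega)))))
  have hTq : T q ∈ M := sub (s₃ (e₂ q (by omega) (by omega)))
  have hTq1 : T (q - 1) ∈ M := sub (s₃ (e₂ (q - 1) (by omega) (by omega)))
  -- The initial rung contains `T (-1)` and three known labels, as `T (-1 - q) = T q`. Since `T
  -- (-1)` is the bottom label at `q - 1`, that position becomes full and starts the chain.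
  have hTneg : T (-1) ∈ M := by
    have hg : prismRung T q 0 ∈ M := sub (s₃ (s₂ (s₁ (s₀ (by simp)))))
    have hper : T (0 - 1 - q) = T q := by rw [← hT]; congr 1; push_cast; ring
    rw [prismRung, hper] at hg
    have := M.sub_mem (M.sub_mem (M.sub_mem hg hT0) hTq) hB0
    convert this using 1
    simp only [zero_sub]; abel
  have down := full_of_rungs_down M (T := T) (h := q) (a := 2) (b := q - 1)
    ⟨hTq1, by convert hTneg using 2; ring⟩
    (fun j h1 h2 => sub (s₃ (s₂ (g₁ j (by omega) (by omega)))))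
    (fun j h1 h2 => (e₁ j (by omega) (by omega)).imp
      (fun H => sub (s₃ (s₂ H))) (fun H => sub (s₃ (s₂ H))))
  refine forall_mem_of_period_of_rung M hT 1 (h := q) (by omega) (by omega)
    (fun j h1 h2 => ?_) (t := q + 1) (sub (by simp)) (Or.inr (Or.inl (by ring)))
  by_cases hj : j ≤ q
  · rcases hj.lt_or_eq with hj | rfl
    · exact (down j (by omega) (by omega)).1
    · exact hTq
  rw [← hT.sub_eq]
  rcases (show j = q + 1 ∨ j = q + 2 ∨ j = 2 * q + 1 ∨ (q + 3 ≤ j ∧ j ≤ 2 * q) by omega) with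
    rfl | rfl | rfl | hj
  · convert hB0 using 2; push_cast; ring
  · convert hB1 using 2; push_cast; ring
  · convert hT0 using 2; push_cast; ring
  · have := (down (j - (2 * q + 1) + q) (by omega) (by omega)).2
    convert this using 2
    push_cast; ring

end Walks

/-! ### From words to prism walks. -/

namespace DihedralConstruction

variable {k m : ℕ}

theorem permute_single (y : DihedralGroup k) (p : ZMod k) (x : ZMod m) :
    permute y (Pi.single p x) = Pi.single (pos y p) x := by
  funext j
  have h : pos y⁻¹ j = p ↔ j = pos y p := by
    constructor
    · rintro rfl; rw [← pos_mul, inv_mul_cancel, pos_one]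
    · rintro rfl; rw [← pos_mul, mul_inv_cancel, pos_one]
  simp only [permute, Pi.single_apply, h]

theorem permute_add (y : DihedralGroup k) (u v : ZMod k → ZMod m) :
    permute y (u + v) = permute y u + permute y v := rfl

theorem fill_singleton (p : ZMod k) (x : ZMod m) : fill {p} x = Pi.single p x := by
  funext j; simp [fill, Pi.single_apply]

theorem fill_insert {p : ZMod k} {P : Finset (ZMod k)} (hp : p ∉ P) (x : ZMod m) :
    fill (insert p P) x = Pi.single p x + fill P x := by
  funext j
  by_cases hj : j = p
  · subst hj; simp [fill, hp]
  · simp [fill, hj]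

theorem elt_zero_one : (elt 0 1 : Grp k m) = 1 := by simp [elt]

theorem elt_right (x : ZMod k → ZMod m) (y : DihedralGroup k) : (elt x y).right = y := by
  simp [elt]

theorem exists_eq_elt (g : Grp k m) : ∃ x y, g = elt x y := by
  refine ⟨permute g.right g.left.toAdd, g.right, ?_⟩
  apply SemidirectProduct.ext
  · apply Multiplicative.toAdd.injective
    funext j
    simp [elt, action_apply, permute, ← pos_mul, pos_one]
  · simp [elt]

theorem elt_injective_left (y : DihedralGroup k) :
    Function.Injective (fun x : ZMod k → ZMod m => elt x y) := by
  intro u v huv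
  simpa [elt] using huv

/-- Every vector generated by `S`, together with `y`, is a product of `n` generators. -/
def Attains (k m n : ℕ) (y : DihedralGroup k) (S : Set (ZMod k → ZMod m)) : Prop :=
  ∀ x ∈ AddSubgroup.closure S, ∃ l : List (Grp k m),
    l.length = n ∧ (∀ z ∈ l, z ∈ gens k m) ∧ l.prod = elt x y

theorem attains_zero : Attains k m 0 1 ∅ := by
  intro x hx
  simp only [AddSubgroup.closure_empty, AddSubgroup.mem_bot] at hx
  subst hx
  exact ⟨[], rfl, by simp, by simp [elt_zero_one]⟩

/-- A letter put in front leaves the contributions of the letters to its right unchanged and adds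
its own vector, moved by `y`. This is why words are read from right to left. -/
theorem Attains.cons {n : ℕ} {y z : DihedralGroup k} {S : Set (ZMod k → ZMod m)}
    (H : Attains k m n y S) {v : ZMod k → ZMod m} {f : ZMod m → (ZMod k → ZMod m)}
    (hf : ∀ t, elt (f t) z ∈ gens k m) (hv : ∀ t : ℤ, permute y (f t) = t • v) :
    Attains k m (n + 1) (z * y) (insert v S) := by
  intro x hx
  rw [Set.insert_eq, AddSubgroup.closure_union, AddSubgroup.mem_sup] at hx
  obtain ⟨u, hu, w, hw, rfl⟩ := hx
  obtain ⟨t, rfl⟩ := AddSubgroup.mem_closure_singleton.1 hu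
  obtain ⟨l, hl, hl', hp⟩ := H w hw
  refine ⟨elt (f t) z :: l, by simp [hl], ?_, ?_⟩
  · simpa using ⟨hf t, hl'⟩
  · rw [List.prod_cons, hp, elt_mul_elt, hv]

theorem single_intCast (p : ZMod k) (t : ℤ) :
    (Pi.single p (t : ZMod m) : ZMod k → ZMod m) = t • Pi.single p 1 := by
  rw [← Pi.single_smul, zsmul_one]

theorem Attains.cons_a {n : ℕ} {y : DihedralGroup k} {S : Set (ZMod k → ZMod m)}
    (H : Attains k m n y S) :
    Attains k m (n + 1) (.r 1 * y) (insert (Pi.single (pos y (half k)) 1) S) :=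
  H.cons (f := fill {(half k : ZMod k)}) (fun t => Or.inl (Or.inl ⟨t, rfl⟩))
    (fun t => by rw [fill_singleton, permute_single, single_intCast])

theorem Attains.cons_A {n : ℕ} {y : DihedralGroup k} {S : Set (ZMod k → ZMod m)}
    (H : Attains k m n y S) :
    Attains k m (n + 1) (.r (-1) * y) (insert (Pi.single (pos y (half k - 1)) 1) S) :=
  H.cons (f := fill {(half k : ZMod k) - 1}) (fun t => Or.inl (Or.inr ⟨t, rfl⟩))
    (fun t => by rw [fill_singleton, permute_single, single_intCast])

theorem intCast_ne_of_lt {k : ℕ} {x y : ℤ} (h1 : x < y) (h2 : y < x + k) :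
    ((x : ℤ) : ZMod k) ≠ (y : ℤ) := by
  rw [Ne, ZMod.intCast_eq_intCast_iff_dvd_sub]
  intro h
  have := Int.le_of_dvd (by omega) h
  omega

theorem half_bounds (hk7 : 7 ≤ k) : 2 ≤ half k ∧ 2 * half k + 3 ≤ k := by
  unfold half; omega

/-- For `k ≥ 7` the four positions are distinct modulo `k`, so nothing collapses in the set. -/
theorem fill_b (hk7 : 7 ≤ k) (x : ZMod m) :
    fill {(half k : ZMod k) - 1, (half k : ZMod k),
      (k : ZMod k) - 1 - half k, (k : ZMod k) - 1 - half k + 1} x =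
    Pi.single ((half k : ZMod k) - 1) x + (Pi.single (half k : ZMod k) x +
      (Pi.single (-1 - half k : ZMod k) x + Pi.single (-half k : ZMod k) x)) := by
  obtain ⟨h2, h3⟩ := half_bounds hk7
  have e1 : (half k : ZMod k) - 1 = ((half k - 1 : ℤ) : ZMod k) := by push_cast; ring
  have e2 : (half k : ZMod k) = ((half k : ℤ) : ZMod k) := by push_cast; ring
  have e3 : -1 - (half k : ZMod k) = ((k - 1 - half k : ℤ) : ZMod k) := by push_cast; simp
  have e4 : -(half k : ZMod k) = ((k - half k : ℤ) : ZMod k) := by push_cast; simp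
  have e5 : (k : ZMod k) - 1 - half k + 1 = - half k := by simp; ring
  rw [e5, CharP.cast_eq_zero (ZMod k) k, zero_sub]
  have n12 : (half k : ZMod k) - 1 ≠ half k := by
    rw [e1, e2]; exact intCast_ne_of_lt (by omega) (by omega)
  have n13 : (half k : ZMod k) - 1 ≠ -1 - half k := by
    rw [e1, e3]; exact intCast_ne_of_lt (by omega) (by omega)
  have n14 : (half k : ZMod k) - 1 ≠ -half k := by
    rw [e1, e4]; exact intCast_ne_of_lt (by omega) (by omega)
  have n23 : (half k : ZMod k) ≠ -1 - half k := by
    rw [e3, e2]; exact intCast_ne_of_lt (by omega) (by omega)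
  have n24 : (half k : ZMod k) ≠ -half k := by
    rw [e4, e2]; exact intCast_ne_of_lt (by omega) (by omega)
  have n34 : -1 - (half k : ZMod k) ≠ -half k := by
    rw [e3, e4]; exact intCast_ne_of_lt (by omega) (by omega)
  rw [fill_insert (by simp [n12, n13, n14]), fill_insert (by simp [n23, n24]),
    fill_insert (by simpa using n34), fill_singleton]

theorem Attains.cons_b (hk7 : 7 ≤ k) {n : ℕ} {y : DihedralGroup k} {S : Set (ZMod k → ZMod m)}
    (H : Attains k m n y S) :
    Attains k m (n + 1) (.sr 0 * y) (insert (Pi.single (pos y (half k - 1)) 1 +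
      (Pi.single (pos y (half k)) 1 + (Pi.single (pos y (-1 - half k)) 1 +
        Pi.single (pos y (-half k)) 1))) S) :=
  H.cons (f := fill {(half k : ZMod k) - 1, (half k : ZMod k),
      (k : ZMod k) - 1 - half k, (k : ZMod k) - 1 - half k + 1}) (fun t => Or.inr ⟨t, rfl⟩)
    (fun t => by
      rw [fill_b hk7]
      simp only [permute_add, permute_single]
      simp only [single_intCast, smul_add])

/-- The element of the dihedral group at position `i` of level `l` of the prism. -/
def vertex (k : ℕ) (l : Bool) (i : ℤ) : DihedralGroup k :=
  if l then .sr i else .r i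

/-- The labels of the top edges, in the order in which `a` traverses them. -/
def label (k m : ℕ) (i : ℤ) : ZMod k → ZMod m := Pi.single ((half k : ZMod k) + i) 1

/-- The labels of the top edges, in the order in which `A` traverses them. -/
def revLabel (k m : ℕ) (i : ℤ) : ZMod k → ZMod m := Pi.single ((half k : ZMod k) - 1 - i) 1

/-- Since `r s = s r⁻¹`, the letters `a` and `A` exchange directions on the bottom level, where the
edge from `i` has its unit vector at `i - half k`; this is the shift by `2 * half k`. -/
theorem attains_of_walk (hk7 : 7 ≤ k) {n : ℕ} {l : Bool} {i : ℤ} {S : Set (ZMod k → ZMod m)}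
    (w : PrismWalk (label k m) (2 * half k) n l i S) : Attains k m n (vertex k l i) S := by
  induction w with
  | nil => simpa [vertex] using attains_zero
  | @forward n l i S w ih =>
    cases l
    · convert ih.cons_a using 1
      · simp [vertex, add_comm]
      · simp [vertex, pos, prismEdge, label]
    · convert ih.cons_A using 1
      · simp [vertex]
      · simp only [vertex, pos, prismEdge, label, if_true]
        congr 2; push_cast; ring
  | @backward n l i S w ih =>
    cases l
    · convert ih.cons_A using 1
      · simp [vertex]; ring
      · simp only [vertex, pos, prismEdge, label, Bool.false_eq_true, if_false]
        congr 2; push_cast; ring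
    · convert ih.cons_a using 1
      · simp [vertex]
      · simp only [vertex, pos, prismEdge, label, if_true]
        congr 2; push_cast; ring
  | @rung n l i S w ih =>
    convert ih.cons_b hk7 using 1
    · cases l <;> simp [vertex]
    · congr 1
      cases l <;> simp only [vertex, pos, prismRung, label, if_true, Bool.false_eq_true, if_false]
      · have e₁ : (half k : ZMod k) + ((i - 1 : ℤ) : ZMod k) = half k - 1 + i := by
          push_cast; ring
        have e₂ : (half k : ZMod k) + ((i - 1 - 2 * half k : ℤ) : ZMod k) = -1 - half k + i := by
          push_cast; ring
        have e₃ : (half k : ZMod k) + ((i - 2 * half k : ℤ) : ZMod k) = -half k + i := by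
          push_cast; ring
        rw [e₁, e₂, e₃]; abel
      · have e₁ : (half k : ZMod k) + ((i - 1 : ℤ) : ZMod k) = -1 - -half k + i := by
          push_cast; ring
        have e₂ : (half k : ZMod k) + i = -1 - (-1 - half k) + i := by ring
        have e₃ : (half k : ZMod k) + ((i - 1 - 2 * half k : ℤ) : ZMod k) = -1 - half k + i := by
          push_cast; ring
        have e₄ : (half k : ZMod k) + ((i - 2 * half k : ℤ) : ZMod k) =
            -1 - (half k - 1) + i := by push_cast; ring
        rw [e₁, e₂, e₃, e₄]; abel

/-- The mirror image under `i ↦ -i`: the shift changes sign, and `k - 2 * half k` represents it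
modulo `k`. -/
theorem attains_of_revWalk (hk7 : 7 ≤ k) {n : ℕ} {l : Bool} {i : ℤ} {S : Set (ZMod k → ZMod m)}
    (w : PrismWalk (revLabel k m) (k - 2 * half k) n l i S) :
    Attains k m n (vertex k l (-i)) S := by
  induction w with
  | nil => simpa [vertex] using attains_zero
  | @forward n l i S w ih =>
    cases l
    · convert ih.cons_A using 1
      · simp [vertex]
      · simp only [vertex, pos, prismEdge, revLabel, Bool.false_eq_true, if_false]
        congr 2; push_cast; ring
    · convert ih.cons_a using 1
      · simp [vertex]; ring
      · simp only [vertex, pos, prismEdge, revLabel, if_true]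
        congr 2; push_cast; simp; ring
  | @backward n l i S w ih =>
    cases l
    · convert ih.cons_a using 1
      · simp [vertex]; ring
      · simp only [vertex, pos, prismEdge, revLabel, Bool.false_eq_true, if_false]
        congr 2; push_cast; ring
    · convert ih.cons_A using 1
      · simp [vertex]; ring
      · simp only [vertex, pos, prismEdge, revLabel, if_true]
        congr 2; push_cast; simp; ring
  | @rung n l i S w ih =>
    convert ih.cons_b hk7 using 1
    · cases l <;> simp [vertex]
    · congr 1
      cases l <;> simp only [vertex, pos, prismRung, revLabel, if_true, Bool.false_eq_true, if_false]
      · have e₁ : (half k : ZMod k) - 1 - ((i - 1 : ℤ) : ZMod k) = half k + (-i : ℤ) := by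
          push_cast; ring
        have e₂ : (half k : ZMod k) - 1 - i = half k - 1 + (-i : ℤ) := by push_cast; ring
        have e₃ : (half k : ZMod k) - 1 - ((i - 1 - (k - 2 * half k) : ℤ) : ZMod k) =
            -half k + (-i : ℤ) := by push_cast; simp; ring
        have e₄ : (half k : ZMod k) - 1 - ((i - (k - 2 * half k) : ℤ) : ZMod k) =
            -1 - half k + (-i : ℤ) := by push_cast; simp; ring
        rw [e₁, e₂, e₃, e₄]; abel
      · have e₁ : (half k : ZMod k) - 1 - ((i - 1 : ℤ) : ZMod k) =
            -1 - (-1 - half k) + (-i : ℤ) := by push_cast; ring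
        have e₂ : (half k : ZMod k) - 1 - i = -1 - -half k + (-i : ℤ) := by push_cast; ring
        have e₃ : (half k : ZMod k) - 1 - ((i - 1 - (k - 2 * half k) : ℤ) : ZMod k) =
            -1 - (half k - 1) + (-i : ℤ) := by push_cast; simp; ring
        have e₄ : (half k : ZMod k) - 1 - ((i - (k - 2 * half k) : ℤ) : ZMod k) =
            -1 - half k + (-i : ℤ) := by push_cast; simp; ring
        rw [e₁, e₂, e₃, e₄]; abel

end DihedralConstruction

/-! ### Targets on the bottom level, by parity. -/

section Walks

variable {V : Type*} [AddCommGroup V] {T : ℤ → V} {h : ℤ} {q : ℕ}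

theorem generatingWalk_bottom_of_even (hT : Function.Periodic T ((2 * q + 1 : ℕ) : ℤ))
    (hq : 3 ≤ q) (hh : h = q ∨ h = q + 1) {t : ℕ} (ht : t ≤ q) (hpar : Even t) :
    GeneratingWalk T h (2 * q + 1) true t := by
  rcases ht.lt_or_eq with ht | rfl
  · simpa [hpar] using generatingWalk_uturn hT (by omega) hh ht
  · rcases hh with rfl | rfl
    · exact generatingWalk_distant hT (by obtain ⟨u, rfl⟩ := hpar; omega) hpar
    · simpa [hpar] using generatingWalk_distant_succ hT hq

theorem generatingWalk_bottom_of_odd (hT : Function.Periodic T ((2 * q + 1 : ℕ) : ℤ))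
    (hq : 3 ≤ q) (hh : h = q ∨ h = q + 1) {t : ℕ} (ht : t ≤ q) (hpar : Odd t) :
    GeneratingWalk T h (2 * q + 1) true ((2 * q + 1 : ℕ) - t) := by
  -- The monotone walk needs `h + t < 2q + 1`, which fails only here.
  by_cases hs : h = q + 1 ∧ t = q
  · obtain ⟨rfl, rfl⟩ := hs
    convert generatingWalk_bottom_succ hT (by omega) hpar using 1
    push_cast; ring
  obtain ⟨u, rfl⟩ := hpar
  rcases hh with rfl | rfl
  · exact_mod_cast generatingWalk_bottom_odd hT q u (by omega) (by omega) (by omega) (by omega)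
  · exact_mod_cast generatingWalk_bottom_odd hT (q + 1) u (by omega) (by omega) (by omega)
      (by omega)

end Walks

/-! ### Covering the whole group. -/

namespace DihedralConstruction

variable {k m : ℕ}

/-- All elements over `y` are products of `k` generators. -/
def Covered (k m : ℕ) (y : DihedralGroup k) : Prop :=
  ∀ x : ZMod k → ZMod m, ∃ l : List (Grp k m),
    l.length = k ∧ (∀ z ∈ l, z ∈ gens k m) ∧ l.prod = elt x y

theorem Attains.covered [NeZero k] {y : DihedralGroup k} {S : Set (ZMod k → ZMod m)}
    (H : Attains k m k y S) (hS : ∀ p, Pi.single p 1 ∈ AddSubgroup.closure S) :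
    Covered k m y := by
  intro x
  refine H x ?_
  rw [← Finset.univ_sum_single x]
  refine AddSubgroup.sum_mem _ fun p _ => ?_
  obtain ⟨t, ht⟩ := ZMod.intCast_surjective (x p)
  rw [← ht, single_intCast]
  exact AddSubgroup.zsmul_mem _ (hS p) t

theorem covered_of_generatingWalk [NeZero k] (hk7 : 7 ≤ k) {l : Bool} {D : ℤ}
    (w : GeneratingWalk (label k m) (2 * half k) k l D) : Covered k m (vertex k l D) := by
  obtain ⟨S, w, hS⟩ := w
  refine (attains_of_walk hk7 w).covered fun p => ?_
  obtain ⟨t, ht⟩ := ZMod.intCast_surjective (p - (half k : ZMod k))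
  have := hS t
  rwa [label, ht, add_sub_cancel] at this

theorem covered_of_generatingRevWalk [NeZero k] (hk7 : 7 ≤ k) {l : Bool} {D : ℤ}
    (w : GeneratingWalk (revLabel k m) (k - 2 * half k) k l D) :
    Covered k m (vertex k l (-D)) := by
  obtain ⟨S, w, hS⟩ := w
  refine (attains_of_revWalk hk7 w).covered fun p => ?_
  obtain ⟨t, ht⟩ := ZMod.intCast_surjective ((half k : ZMod k) - 1 - p)
  have := hS t
  rwa [revLabel, ht, sub_sub_cancel] at this

theorem label_periodic : Function.Periodic (label k m) k := by
  intro i; simp [label]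

theorem revLabel_periodic : Function.Periodic (revLabel k m) k := by
  intro i; simp [revLabel]

/-- Up to orientation, the labels shift by `q` in one direction and by `q + 1` in the other. -/
theorem exists_labellings {q : ℕ} (hq : 3 ≤ q) :
    ∃ (σ : ℤ) (T₁ T₂ : ℤ → ZMod (2 * q + 1) → ZMod m), (σ = 1 ∨ σ = -1) ∧
      Function.Periodic T₁ ((2 * q + 1 : ℕ) : ℤ) ∧ Function.Periodic T₂ ((2 * q + 1 : ℕ) : ℤ) ∧
      (∀ l D, GeneratingWalk T₁ q (2 * q + 1) l D →
        Covered (2 * q + 1) m (vertex _ l (σ * D))) ∧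
      ∀ l D, GeneratingWalk T₂ (q + 1) (2 * q + 1) l D →
        Covered (2 * q + 1) m (vertex _ l (-σ * D)) := by
  rcases Nat.even_or_odd q with ⟨u, hu⟩ | ⟨u, hu⟩
  · have hh : half (2 * q + 1) = u := by unfold half; omega
    refine ⟨1, label _ m, revLabel _ m, Or.inl rfl, label_periodic, revLabel_periodic,
      fun l D w => ?_, fun l D w => ?_⟩
    · rw [one_mul]
      refine covered_of_generatingWalk (by omega) ?_
      convert w using 1; omega
    · rw [neg_one_mul]
      refine covered_of_generatingRevWalk (by omega) ?_
      convert w using 1; omega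
  · have hh : half (2 * q + 1) = u + 1 := by unfold half; omega
    refine ⟨-1, revLabel _ m, label _ m, Or.inr rfl, revLabel_periodic, label_periodic,
      fun l D w => ?_, fun l D w => ?_⟩
    · rw [neg_one_mul]
      refine covered_of_generatingRevWalk (by omega) ?_
      convert w using 1; omega
    · rw [neg_neg, one_mul]
      refine covered_of_generatingWalk (by omega) ?_
      convert w using 1; omega

theorem a_mul_A (x : ZMod m) : (a x : Grp k m) * A (-x) = 1 := by
  rw [a, A, elt_mul_elt, fill_singleton, fill_singleton, permute_single, ← elt_zero_one]
  congr 1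
  · simp [pos, ← sub_eq_add_neg, ← Pi.single_add]
  · simp

theorem a_inv (x : ZMod m) : (a x : Grp k m)⁻¹ = A (-x) := inv_eq_of_mul_eq_one_right (a_mul_A x)

theorem A_inv (x : ZMod m) : (A x : Grp k m)⁻¹ = a (-x) := by
  have := a_inv (k := k) (-x)
  rw [neg_neg] at this
  rw [← this, inv_inv]

theorem b_inv (x : ZMod m) : (b x : Grp k m)⁻¹ = b (-x) := by
  refine inv_eq_of_mul_eq_one_right ?_
  rw [b, b, elt_mul_elt, ← elt_zero_one]
  congr 1
  · funext j
    have h : pos (.sr 0 : DihedralGroup k) j ∈ ({(half k : ZMod k) - 1, (half k : ZMod k),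
        (k : ZMod k) - 1 - half k, (k : ZMod k) - 1 - half k + 1} : Finset (ZMod k)) ↔
        j ∈ ({(half k : ZMod k) - 1, (half k : ZMod k),
        (k : ZMod k) - 1 - half k, (k : ZMod k) - 1 - half k + 1} : Finset (ZMod k)) := by
      simp only [pos, Finset.mem_insert, Finset.mem_singleton, CharP.cast_eq_zero]
      have e₁ : -1 - j + 0 = (half k : ZMod k) - 1 ↔ j = 0 - 1 - (half k : ZMod k) + 1 := by
        constructor <;> intro h <;> linear_combination -h
      have e₂ : -1 - j + 0 = (half k : ZMod k) ↔ j = 0 - 1 - (half k : ZMod k) := by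
        constructor <;> intro h <;> linear_combination -h
      have e₃ : -1 - j + 0 = 0 - 1 - (half k : ZMod k) ↔ j = half k := by
        constructor <;> intro h <;> linear_combination -h
      have e₄ : -1 - j + 0 = 0 - 1 - (half k : ZMod k) + 1 ↔ j = (half k : ZMod k) - 1 := by
        constructor <;> intro h <;> linear_combination -h
      rw [e₁, e₂, e₃, e₄]; tauto
    simp only [permute, DihedralGroup.inv_sr, Pi.add_apply, fill, h]
    split_ifs <;> simp
  · simp

theorem inv_mem_gens {g : Grp k m} (hg : g ∈ gens k m) : g⁻¹ ∈ gens k m := by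
  rcases hg with (⟨x, rfl⟩ | ⟨x, rfl⟩) | ⟨x, rfl⟩
  · rw [a_inv]; exact Or.inl (Or.inr ⟨_, rfl⟩)
  · rw [A_inv]; exact Or.inl (Or.inl ⟨_, rfl⟩)
  · rw [b_inv]; exact Or.inr ⟨_, rfl⟩

/-- Reversing a word and inverting its letters stays within the generators and keeps the length. -/
theorem Covered.inv {y : DihedralGroup k} (H : Covered k m y) : Covered k m y⁻¹ := by
  intro x
  obtain ⟨x', y', h⟩ := exists_eq_elt (elt x y⁻¹ : Grp k m)⁻¹
  have hy : y' = y := by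
    have := congrArg SemidirectProduct.right h
    rwa [SemidirectProduct.inv_right, elt_right, elt_right, inv_inv, eq_comm] at this
  subst hy
  obtain ⟨l, hl, hl', hp⟩ := H x'
  refine ⟨(l.map (·⁻¹)).reverse, by simpa using hl, fun z hz => ?_, ?_⟩
  · simp only [List.mem_reverse, List.mem_map] at hz
    obtain ⟨z', hz', rfl⟩ := hz
    exact inv_mem_gens (hl' z' hz')
  · rw [← List.prod_inv_reverse, hp, ← h, inv_inv]

theorem Covered.congr {y z : DihedralGroup k} (H : Covered k m y) (h : y = z) :
    Covered k m z := h ▸ H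

/-- The exponent is `±t` with `t ≤ q`. For rotations, inversion makes the sign irrelevant.
Reflections are their own inverses, so there the sign is matched by the choice of orientation, and
both shifts are needed. -/
theorem covered_all {q : ℕ} (hq : 3 ≤ q) (y : DihedralGroup (2 * q + 1)) :
    Covered (2 * q + 1) m y := by
  obtain ⟨σ, T₁, T₂, hσ, hT₁, hT₂, H₁, H₂⟩ := exists_labellings (m := m) hq
  have hk0 : ((2 * q + 1 : ℕ) : ZMod (2 * q + 1)) = 0 := CharP.cast_eq_zero _ _
  have abs (j : ZMod (2 * q + 1)) : ∃ t : ℕ, t ≤ q ∧ (j = (σ * t : ℤ) ∨ j = (-σ * t : ℤ)) := by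
    refine ⟨j.valMinAbs.natAbs, by have := ZMod.natAbs_valMinAbs_le j; omega, ?_⟩
    have hj := ZMod.coe_valMinAbs j
    have hj' : j.valMinAbs = σ * j.valMinAbs.natAbs ∨ j.valMinAbs = -σ * j.valMinAbs.natAbs := by
      rcases hσ with rfl | rfl <;> omega
    rcases hj' with h | h
    · left; rw [← h, hj]
    · right; rw [← h, hj]
  cases y with
  | r j =>
    obtain ⟨t, ht, hj⟩ := abs j
    have key : Covered (2 * q + 1) m (.r ((σ * t : ℤ) : ZMod (2 * q + 1))) ∨
        Covered (2 * q + 1) m (.r ((-σ * t : ℤ) : ZMod (2 * q + 1))) := by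
      rcases Nat.even_or_odd t with hpar | hpar
      · right
        obtain ⟨u, rfl⟩ := hpar
        refine Covered.congr (H₁ false _ (generatingWalk_top_even hT₁ q u (by omega)
          (by omega) (by omega))) ?_
        simp only [vertex, Bool.false_eq_true, if_false]
        congr 1
        push_cast at hk0 ⊢
        rw [hk0]; ring
      · rcases ht.lt_or_eq with ht | rfl
        · left
          have := H₁ _ _ (generatingWalk_uturn hT₁ (by omega) (Or.inl rfl) ht)
          simpa [vertex, Nat.not_even_iff_odd.2 hpar] using this
        · right
          have := H₂ _ _ (generatingWalk_distant_succ hT₂ hq)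
          simpa [vertex, Nat.not_even_iff_odd.2 hpar] using this
    have e : (.r ((σ * t : ℤ) : ZMod (2 * q + 1)) : DihedralGroup (2 * q + 1))⁻¹ =
        .r ((-σ * t : ℤ) : ZMod (2 * q + 1)) := by simp
    have e' : (.r ((-σ * t : ℤ) : ZMod (2 * q + 1)) : DihedralGroup (2 * q + 1))⁻¹ =
        .r ((σ * t : ℤ) : ZMod (2 * q + 1)) := by simp
    rcases key with key | key <;> rcases hj with rfl | rfl
    · exact key
    · exact e ▸ key.inv
    · exact e' ▸ key.inv
    · exact key
  | sr j =>
    obtain ⟨t, ht, hj⟩ := abs j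
    rcases Nat.even_or_odd t with hpar | hpar
    · rcases hj with rfl | rfl
      · exact H₁ true _ (generatingWalk_bottom_of_even hT₁ hq (Or.inl rfl) ht hpar)
      · exact H₂ true _ (generatingWalk_bottom_of_even hT₂ hq (Or.inr rfl) ht hpar)
    · rcases hj with rfl | rfl
      · refine Covered.congr
          (H₂ true _ (generatingWalk_bottom_of_odd hT₂ hq (Or.inr rfl) ht hpar)) ?_
        simp only [vertex, if_true]
        congr 1
        push_cast at hk0 ⊢
        rw [hk0]; ring
      · refine Covered.congr
          (H₁ true _ (generatingWalk_bottom_of_odd hT₁ hq (Or.inl rfl) ht hpar)) ?_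
        simp only [vertex, if_true]
        congr 1
        push_cast at hk0 ⊢
        rw [hk0]; ring

theorem exists_list_prod_eq (hk : Odd k) (hk7 : 7 ≤ k) (g : Grp k m) :
    ∃ l : List (Grp k m), l.length = k ∧ (∀ y ∈ l, y ∈ gens k m) ∧ l.prod = g := by
  obtain ⟨q, rfl⟩ := hk
  obtain ⟨x, y, rfl⟩ := exists_eq_elt g
  exact covered_all (by omega) y x

theorem one_notMem_gens (hk7 : 7 ≤ k) : (1 : Grp k m) ∉ gens k m := by
  have : Fact (1 < k) := ⟨by omega⟩
  rintro ((⟨x, hx⟩ | ⟨x, hx⟩) | ⟨x, hx⟩) <;>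
  · have := congrArg SemidirectProduct.right hx
    rw [SemidirectProduct.one_right, DihedralGroup.one_def] at this
    simp [a, A, b, elt_right, -DihedralGroup.r_zero] at this

theorem card_grp [NeZero k] [NeZero m] : Nat.card (Grp k m) = 2 * k * m ^ k := by
  rw [SemidirectProduct.card, DihedralGroup.nat_card]
  simp [Nat.card_eq_fintype_card, ZMod.card]
  ring

theorem ncard_gens (hk7 : 7 ≤ k) [NeZero m] : (gens k m).ncard = 3 * m := by
  have h2 : Fact (2 < k) := ⟨by omega⟩
  have h1 : Fact (1 < k) := ⟨by omega⟩
  have fill_inj (P : Finset (ZMod k)) (p : ZMod k) (hp : p ∈ P) :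
      Function.Injective (fill P : ZMod m → _) := fun x y hxy => by
    simpa [fill, hp] using congrFun hxy p
  have ia : Function.Injective (a : ZMod m → Grp k m) :=
    (elt_injective_left _).comp (fill_inj _ (half k) (by simp))
  have iA : Function.Injective (A : ZMod m → Grp k m) :=
    (elt_injective_left _).comp (fill_inj _ (half k - 1) (by simp))
  have ib : Function.Injective (b : ZMod m → Grp k m) :=
    (elt_injective_left _).comp (fill_inj _ (half k) (by simp))
  have card (f : ZMod m → Grp k m) (hf : Function.Injective f) : (Set.range f).ncard = m := by
    rw [← Set.image_univ, Set.ncard_image_of_injective _ hf, Set.ncard_univ, Nat.card_zmod]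
  have fin (f : ZMod m → Grp k m) : (Set.range f).Finite := Set.finite_range f
  rw [gens, Set.ncard_union_eq _ ((fin _).union (fin _)) (fin _),
    Set.ncard_union_eq _ (fin _) (fin _), card _ ia, card _ iA, card _ ib]
  · ring
  · rw [Set.disjoint_left]
    rintro _ ⟨x, rfl⟩ ⟨y, hy⟩
    have := congrArg SemidirectProduct.right hy
    simp [a, A, elt_right] at this
    exact ZMod.neg_one_ne_one this
  · rw [Set.disjoint_left]
    rintro _ (⟨x, rfl⟩ | ⟨x, rfl⟩) ⟨y, hy⟩ <;>
    · have := congrArg SemidirectProduct.right hy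
      simp [a, A, b, elt_right] at this

end DihedralConstruction

/-! ### Degree, order and diameter of Cayley graphs. -/

section Cayley

open scoped Pointwise

variable {G : Type*} [Group G] {S : Set G}

theorem mulCayley_adj_iff (h1 : (1 : G) ∉ S) (hinv : ∀ s ∈ S, s⁻¹ ∈ S) (u v : G) :
    (SimpleGraph.mulCayley S).Adj u v ↔ u⁻¹ * v ∈ S := by
  rw [SimpleGraph.mulCayley_adj']
  constructor
  · rintro ⟨-, g, hg, rfl | rfl⟩
    · simpa using hg
    · simpa using hinv g hg
  · intro h
    refine ⟨?_, _, h, Or.inl (by simp)⟩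
    rintro rfl
    exact h1 (by simpa using h)

theorem maxDegree_mulCayley [Fintype G] [DecidableRel (SimpleGraph.mulCayley S).Adj]
    (h1 : (1 : G) ∉ S) (hinv : ∀ s ∈ S, s⁻¹ ∈ S) :
    (SimpleGraph.mulCayley S).maxDegree = S.ncard := by
  have hdeg : ∀ v, (SimpleGraph.mulCayley S).degree v = S.ncard := by
    intro v
    have : (SimpleGraph.mulCayley S).neighborSet v = (v * ·) '' S := by
      ext u
      rw [SimpleGraph.mem_neighborSet, mulCayley_adj_iff h1 hinv]
      constructor
      · exact fun h => ⟨_, h, by simp⟩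
      · rintro ⟨s, hs, rfl⟩; simpa using hs
    rw [← SimpleGraph.card_neighborSet_eq_degree, ← Nat.card_eq_fintype_card,
      Nat.card_coe_set_eq, this, Set.ncard_image_of_injective _ (mul_right_injective v)]
  refine le_antisymm (SimpleGraph.maxDegree_le_of_forall_degree_le _ _ fun v => (hdeg v).le) ?_
  rw [← hdeg 1]
  exact SimpleGraph.degree_le_maxDegree _ _

/-- A vertex-counting bound for Cayley graphs of diameter at most `n`. -/
theorem card_le_of_ediam_le [Fintype G] (h1 : (1 : G) ∉ S) (hinv : ∀ s ∈ S, s⁻¹ ∈ S) {n : ℕ}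
    (hd : (SimpleGraph.mulCayley S).ediam ≤ n) : Fintype.card G ≤ (S.ncard + 1) ^ n := by
  classical
  have walk : ∀ {u v : G} (p : (SimpleGraph.mulCayley S).Walk u v),
      u⁻¹ * v ∈ (insert 1 S) ^ p.length := by
    intro u v p
    induction p with
    | nil => simp
    | @cons u v w h p ih =>
      rw [SimpleGraph.Walk.length_cons, pow_succ']
      refine ⟨u⁻¹ * v, Or.inr ((mulCayley_adj_iff h1 hinv u v).1 h), _, ih, ?_⟩
      simp [mul_assoc]
  -- The adjoined `1` pads shorter walks to exactly `n` factors.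
  have huniv : (insert 1 S.toFinset : Finset G) ^ n = Finset.univ := by
    refine Finset.eq_univ_of_forall fun v => ?_
    have hv : (SimpleGraph.mulCayley S).edist 1 v ≤ n := SimpleGraph.edist_le_ediam.trans hd
    obtain ⟨p, hp⟩ := SimpleGraph.exists_walk_of_edist_ne_top
      (ne_top_of_le_ne_top (ENat.natCast_ne_top n) hv)
    have hmem := walk p
    have hle : p.length ≤ n := by
      rw [← hp] at hv; exact_mod_cast hv
    have := Set.pow_subset_pow_right (Set.mem_insert 1 S) hle hmem
    rw [← Finset.mem_coe]
    simpa using this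
  calc Fintype.card G = ((insert 1 S.toFinset : Finset G) ^ n).card := by rw [huniv]; rfl
    _ ≤ (insert 1 S.toFinset : Finset G).card ^ n := Finset.card_pow_le
    _ ≤ (S.ncard + 1) ^ n := by
      gcongr
      rw [Set.ncard_eq_toFinset_card']
      exact Finset.card_insert_le _ _

theorem edist_mul_prod_le (h1 : (1 : G) ∉ S) (hinv : ∀ s ∈ S, s⁻¹ ∈ S) (l : List G)
    (hl : ∀ z ∈ l, z ∈ S) (u : G) : (SimpleGraph.mulCayley S).edist u (u * l.prod) ≤ l.length := by
  induction l generalizing u with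
  | nil => simp
  | cons z l ih =>
    have hadj : (SimpleGraph.mulCayley S).Adj u (u * z) :=
      (mulCayley_adj_iff h1 hinv _ _).2 (by simpa using hl z (by simp))
    have h2 := ih (fun y hy => hl y (by simp [hy])) (u * z)
    rw [mul_assoc, ← List.prod_cons] at h2
    refine SimpleGraph.edist_triangle.trans ((add_le_add (SimpleGraph.edist_eq_one_iff_adj.2 hadj).le
      h2).trans ?_)
    rw [List.length_cons, add_comm]; push_cast; rfl

/-- Needed because `sSup` of an unbounded set of naturals is `0`. -/
theorem bddAbove_cayleyOrder (d k : ℕ) : BddAbove {n : ℕ | CayleyOrder d k n} := by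
  classical
  refine ⟨(d + 1) ^ k, ?_⟩
  rintro n ⟨G, _, _, S, h1, hinv, hdiam, hdeg, rfl⟩
  rw [maxDegree_mulCayley h1 hinv] at hdeg
  rw [← hdeg]
  exact card_le_of_ediam_le h1 hinv hdiam.le

/-- An inverse-closed set all of whose `k`-fold products exhaust a group that is too large for
diameter `k - 1` yields a Cayley graph of diameter exactly `k`. -/
theorem cayleyOrder_of_forall_prod {G : Type} [Group G] [Fintype G] {S : Set G}
    (h1 : (1 : G) ∉ S) (hinv : ∀ s ∈ S, s⁻¹ ∈ S) {k : ℕ}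
    (hprod : ∀ g : G, ∃ l : List G, l.length = k + 1 ∧ (∀ z ∈ l, z ∈ S) ∧ l.prod = g)
    (hcard : (S.ncard + 1) ^ k < Fintype.card G) :
    CayleyOrder S.ncard (k + 1) (Fintype.card G) := by
  classical
  refine ⟨G, inferInstance, inferInstance, S, h1, hinv, le_antisymm ?_ ?_,
    maxDegree_mulCayley h1 hinv, rfl⟩
  · refine SimpleGraph.ediam_le_of_edist_le fun u v => ?_
    obtain ⟨l, hl, hS, hp⟩ := hprod (u⁻¹ * v)
    have := edist_mul_prod_le h1 hinv l hS u
    rwa [hp, hl, mul_inv_cancel_left] at this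
  · by_contra hlt
    rw [not_le] at hlt
    have : (SimpleGraph.mulCayley S).ediam ≤ k := by
      push_cast at hlt
      exact Order.le_of_lt_add_one hlt
    exact absurd (card_le_of_ediam_le h1 hinv this) (not_le.2 hcard)

end Cayley

/-! ### All large degrees, and the density. -/

namespace DihedralConstruction

variable {k m : ℕ}

/-- The involutions `(0; s r ^ i)` for `1 ≤ i ≤ ρ`. -/
def involutions (k m ρ : ℕ) : Set (Grp k m) :=
  (fun i : ℕ => elt 0 (.sr (i : ZMod k))) '' Set.Icc 1 ρ

theorem inv_involution (i : ZMod k) : (elt 0 (.sr i) : Grp k m)⁻¹ = elt 0 (.sr i) := by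
  refine inv_eq_of_mul_eq_one_right ?_
  rw [elt_mul_elt, ← elt_zero_one]
  congr 1
  · funext j; simp [permute]
  · simp

theorem natCast_injOn_lt {k ρ : ℕ} (hρ : ρ < k) :
    Set.InjOn (fun i : ℕ => (i : ZMod k)) (Set.Iic ρ) := by
  intro i hi j hj hij
  simp only [Set.mem_Iic] at hi hj
  have := (ZMod.natCast_eq_natCast_iff' i j k).1 hij
  rwa [Nat.mod_eq_of_lt (by omega), Nat.mod_eq_of_lt (by omega)] at this

theorem ncard_involutions {ρ : ℕ} (hρ : ρ < k) : (involutions k m ρ).ncard = ρ := by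
  rw [involutions, Set.InjOn.ncard_image]
  · simp [Set.ncard_eq_toFinset_card']
  · intro i hi j hj hij
    have := congrArg SemidirectProduct.right hij
    simp only [elt_right, DihedralGroup.sr.injEq] at this
    exact natCast_injOn_lt hρ hi.2 hj.2 this

theorem disjoint_involutions {ρ : ℕ} (hρ : ρ < k) : Disjoint (gens k m) (involutions k m ρ) := by
  rw [Set.disjoint_left]
  rintro _ h ⟨i, hi, rfl⟩
  rcases h with (⟨x, hx⟩ | ⟨x, hx⟩) | ⟨x, hx⟩ <;>
    have := congrArg SemidirectProduct.right hx <;>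
    simp only [a, A, b, elt_right, DihedralGroup.sr.injEq, reduceCtorEq] at this
  have h0 : (fun i : ℕ => (i : ZMod k)) 0 = (fun i : ℕ => (i : ZMod k)) i := by simpa using this
  have := natCast_injOn_lt hρ (by simp) hi.2 h0
  have := hi.1
  omega

/-- The `ρ` involutions only adjust the degree; the words covering the group do not use them. The
size of `m` serves to exclude a smaller diameter. -/
theorem cayleyOrder_grp (hk : Odd k) (hk7 : 7 ≤ k) {ρ : ℕ} (hρ : ρ ≤ 2) (hm : 6 ^ k ≤ m) :
    CayleyOrder (3 * m + ρ) k (2 * k * m ^ k) := by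
  have hm0 : 0 < m := lt_of_lt_of_le (by positivity) hm
  have : NeZero m := ⟨hm0.ne'⟩
  have : NeZero k := ⟨by omega⟩
  have : Finite (Grp k m) := Finite.of_equiv _ SemidirectProduct.equivProd.symm
  have : Fintype (Grp k m) := Fintype.ofFinite _
  obtain ⟨n, rfl⟩ : ∃ n, k = n + 1 := ⟨k - 1, by omega⟩
  have hS : (gens (n + 1) m ∪ involutions (n + 1) m ρ).ncard = 3 * m + ρ := by
    rw [Set.ncard_union_eq (disjoint_involutions (by omega)) (Set.toFinite _) (Set.toFinite _),
      ncard_gens hk7, ncard_involutions (by omega)]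
  have hG : Fintype.card (Grp (n + 1) m) = 2 * (n + 1) * m ^ (n + 1) := by
    rw [← Nat.card_eq_fintype_card, card_grp]
  rw [← hS, ← hG]
  refine cayleyOrder_of_forall_prod ?_ ?_ ?_ ?_
  · rintro (h | ⟨i, -, h⟩)
    · exact one_notMem_gens hk7 h
    · have := congrArg SemidirectProduct.right h
      rw [SemidirectProduct.one_right, DihedralGroup.one_def, elt_right] at this
      cases this
  · rintro s (hs | ⟨i, hi, rfl⟩)
    · exact Or.inl (inv_mem_gens hs)
    · exact Or.inr ⟨i, hi, (inv_involution _).symm⟩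
  · intro g
    obtain ⟨l, hl, hl', hp⟩ := exists_list_prod_eq hk hk7 g
    exact ⟨l, hl, fun z hz => Or.inl (hl' z hz), hp⟩
  · rw [hS, hG]
    -- Here `ρ + 1 ≤ 3 * m`, and `6 ^ (n + 1) ≤ m` absorbs the constant into one more factor `m`.
    calc (3 * m + ρ + 1) ^ n ≤ (6 * m) ^ n := by gcongr; omega
      _ = 6 ^ n * m ^ n := mul_pow _ _ _
      _ < 6 ^ (n + 1) * m ^ n := by
        have : 6 ^ n < 6 ^ (n + 1) := Nat.pow_lt_pow_right (by norm_num) (by omega)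
        gcongr
      _ ≤ m * m ^ n := by gcongr
      _ ≤ 2 * (n + 1) * m ^ (n + 1) := by
        rw [← pow_succ']
        exact Nat.le_mul_of_pos_left _ (by positivity)

theorem le_maxCayleyOrder (hk : Odd k) (hk7 : 7 ≤ k) {d : ℕ} (hd : 3 * 6 ^ k ≤ d) :
    2 * k * (d / 3) ^ k ≤ maxCayleyOrder d k := by
  refine le_csSup (bddAbove_cayleyOrder d k) ?_
  have := cayleyOrder_grp hk hk7 (ρ := d % 3) (m := d / 3) (by omega) (by omega)
  rwa [Nat.div_add_mod] at this

theorem le_lowerCayleyDensity (hk : Odd k) (hk7 : 7 ≤ k) :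
    ((2 * (k : ℝ) / 3 ^ k : ℝ) : EReal) ≤ lowerCayleyDensity k := by
  have hdiv : Tendsto (fun d : ℕ => ((d / 3 : ℕ) : ℝ) / d) atTop (nhds (1 / 3)) := by
    have h1 := (tendsto_nat_floor_mul_div_atTop (R := ℝ) (a := 1 / 3) (by norm_num)).comp
      tendsto_natCast_atTop_atTop
    refine h1.congr fun d => ?_
    have : ⌊(1 / 3 : ℝ) * d⌋₊ = d / 3 := by
      rw [← Nat.floor_div_eq_div (K := ℝ)]
      congr 1; push_cast; ring
    simp [Function.comp, ← this]
  have hlim : Tendsto (fun d : ℕ => 2 * (k : ℝ) * (((d / 3 : ℕ) : ℝ) / d) ^ k) atTop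
      (nhds (2 * (k : ℝ) / 3 ^ k)) := by
    have := (hdiv.pow k).const_mul (2 * (k : ℝ))
    convert this using 2
    rw [one_div, inv_pow]; rfl
  have hlim' := (continuous_coe_real_ereal.tendsto _).comp hlim
  rw [← hlim'.liminf_eq, lowerCayleyDensity]
  refine liminf_le_liminf ?_
  filter_upwards [eventually_ge_atTop (3 * 6 ^ k)] with d hd
  rw [Function.comp, EReal.coe_le_coe_iff, div_pow, ← mul_div_assoc]
  gcongr
  exact_mod_cast le_maxCayleyOrder hk hk7 hd

end DihedralConstruction

theorem theorem4 (k : ℕ) (hk : Odd k) (hk7 : 7 ≤ k) :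
    (((2 * (k : ℝ) / 3 ^ k : ℝ) : EReal) ≤ lowerCayleyDensity k) ∧
    ∀ m : ℕ, 2 ≤ m →
      Nat.card (DihedralConstruction.Grp k m) = 2 * k * m ^ k ∧
      (1 : DihedralConstruction.Grp k m) ∉ DihedralConstruction.gens k m ∧
      (∀ g ∈ DihedralConstruction.gens k m, g⁻¹ ∈ DihedralConstruction.gens k m) ∧
      (DihedralConstruction.gens k m).ncard = 3 * m ∧
      ∀ g : DihedralConstruction.Grp k m, ∃ l : List (DihedralConstruction.Grp k m),
        l.length = k ∧ (∀ y ∈ l, y ∈ DihedralConstruction.gens k m) ∧ l.prod = g := by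
  refine ⟨DihedralConstruction.le_lowerCayleyDensity hk hk7, fun m hm => ?_⟩
  have : NeZero m := ⟨by omega⟩
  have : NeZero k := ⟨by omega⟩
  exact ⟨DihedralConstruction.card_grp, DihedralConstruction.one_notMem_gens hk7,
    fun _ => DihedralConstruction.inv_mem_gens, DihedralConstruction.ncard_gens hk7,
    DihedralConstruction.exists_list_prod_eq hk hk7⟩
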